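/- All graphs are finite, simple and undirected. For a graph $G$, let $q(G)$ be the signless Laplacian spectral radius, i.e. the largest eigenvalue of $Q(G)=D(G)+A(G)$, where $D(G)$ is the diagonal matrix of vertex degrees and $A(G)$ is the adjacency matrix. A graph is planar if it can be drawn in the plane in such a way that edges meet only at points corresponding to their common ends; a planar graph is maximal if no edge can be added to it without violating planarity. Let $\Delta(G)$ and $\Delta'(G)$ denote the largest and the second largest vertex degree (degrees counted with multiplicity), and let $K_2\nabla P_{n-2}$ be the join of the complete graph $K_2$ and the path $P_{n-2}$ on $n-2$ vertices, i.e. their disjoint union together with all edges between them. Let $G$ be a maximal planar graph of order $n\ge 15$ with a vertex $v_1$ such that $d_G(v_1)=\Delta(G)=n-1$. (i) If $\Delta'(G)=n-2$, then $q(G)<q(K_2\nabla P_{n-2})$. (ii) If $\Delta'(G)=n-3$, then $q(G)<q(K_2\nabla P_{n-2})$. -/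

import Mathlib

/-- A drawing of the simple graph `G` in the Euclidean plane in which edges meet only at points
corresponding to their common ends. Vertices are distinct points; every edge `uv` is a simple
curve (an injective path) from the point of `u` to the point of `v`, the same curve traversed
backwards for `vu`; a curve passes through no vertex other than its two ends; and two curves that
belong to different edges meet only at the point of a common end. -/
structure PlaneDrawing {V : Type*} (G : SimpleGraph V) where
  point : V → EuclideanSpace ℝ (Fin 2)
  point_injective : Function.Injective point
  curve : ∀ u v : V, G.Adj u v → Path (point u) (point v)
  curve_symm : ∀ (u v : V) (h : G.Adj u v), curve v u h.symm = (curve u v h).symm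
  curve_injective : ∀ (u v : V) (h : G.Adj u v), Function.Injective (curve u v h)
  curve_avoids : ∀ (u v : V) (h : G.Adj u v) (t : unitInterval) (w : V),
    curve u v h t = point w → w = u ∨ w = v
  curve_meet : ∀ (u v : V) (h : G.Adj u v) (u' v' : V) (h' : G.Adj u' v'),
    s(u, v) ≠ s(u', v') → ∀ t t' : unitInterval, curve u v h t = curve u' v' h' t' →
      ∃ w : V, w ∈ s(u, v) ∧ w ∈ s(u', v') ∧ curve u v h t = point w

/-- A graph is planar if it has a drawing in the plane. -/
def IsPlanarGraph {V : Type*} (G : SimpleGraph V) : Prop :=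
  Nonempty (PlaneDrawing G)

/-- A planar graph is maximal if no edge can be added to it without violating planarity. -/
def IsMaximalPlanarGraph {V : Type*} (G : SimpleGraph V) : Prop :=
  IsPlanarGraph G ∧
    ∀ u v : V, u ≠ v → ¬ G.Adj u v → ¬ IsPlanarGraph (G ⊔ SimpleGraph.edge u v)

/-- The signless Laplacian matrix `Q(G) = D(G) + A(G)`. -/
def signlessLaplacian {V : Type*} [Fintype V] [DecidableEq V] (G : SimpleGraph V)
    [DecidableRel G.Adj] : Matrix V V ℝ :=
  G.degMatrix ℝ + G.adjMatrix ℝ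

open scoped Classical in
/-- The signless Laplacian spectral radius `q(G)`: the largest eigenvalue of `Q(G)`. -/
noncomputable def signlessRadius {V : Type*} [Fintype V] (G : SimpleGraph V) : ℝ :=
  sSup {μ : ℝ | Module.End.HasEigenvalue (Matrix.toLin' (signlessLaplacian G)) μ}

open scoped Classical in
/-- On a nonempty vertex set, `q(G)` is attained: it is the greatest eigenvalue. -/
theorem isGreatest_signlessRadius {V : Type*} [Fintype V] [Nonempty V] (G : SimpleGraph V) :
    IsGreatest {μ : ℝ | Module.End.HasEigenvalue (Matrix.toLin' (signlessLaplacian G)) μ}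
      (signlessRadius G) := by
  have hfin : {μ : ℝ | Module.End.HasEigenvalue
      (Matrix.toLin' (signlessLaplacian G)) μ}.Finite :=
    Module.End.finite_hasEigenvalue _
  have hherm : (signlessLaplacian G).IsHermitian := by
    refine Matrix.IsHermitian.add ?_ ?_
    · exact Matrix.isHermitian_diagonal _
    · exact Matrix.IsHermitian.ext fun i j => by simp [SimpleGraph.adj_comm]
  have hne : {μ : ℝ | Module.End.HasEigenvalue
      (Matrix.toLin' (signlessLaplacian G)) μ}.Nonempty := by
    obtain ⟨v⟩ := ‹Nonempty V›
    refine ⟨hherm.eigenvalues v, ?_⟩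
    rw [Set.mem_ofPred_eq, Module.End.hasEigenvalue_iff_mem_spectrum, Matrix.spectrum_toLin']
    exact hherm.eigenvalues_mem_spectrum_real v
  exact ⟨hne.csSup_mem hfin, fun μ hμ => le_csSup hfin.bddAbove hμ⟩

/-- The second largest vertex degree `Δ'(G)`: the largest entry of the family of all vertex
degrees after one occurrence of the largest degree has been removed. -/
def secondMaxDegree {V : Type*} [Fintype V] (G : SimpleGraph V) [DecidableRel G.Adj] : ℕ :=
  (((Finset.univ : Finset V).val.map fun v => G.degree v).erase G.maxDegree).sup

/-- The join `G ∇ H`: the disjoint union of `G` and `H` together with all edges between them. -/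
def joinGraph {V W : Type*} (G : SimpleGraph V) (H : SimpleGraph W) : SimpleGraph (V ⊕ W) where
  Adj
    | Sum.inl a, Sum.inl b => G.Adj a b
    | Sum.inr a, Sum.inr b => H.Adj a b
    | Sum.inl _, Sum.inr _ => True
    | Sum.inr _, Sum.inl _ => True
  symm := ⟨by
    rintro (a | a) (b | b) h
    · exact SimpleGraph.Adj.symm h
    · trivial
    · trivial
    · exact SimpleGraph.Adj.symm h⟩
  loopless := ⟨by
    rintro (a | a) h
    · exact G.irrefl h
    · exact H.irrefl h⟩

/-- The graph `K₂ ∇ P_{n-2}`, which has order `n` for `n ≥ 2`. -/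
def joinK2Path (n : ℕ) : SimpleGraph (Fin 2 ⊕ Fin (n - 2)) :=
  joinGraph (SimpleGraph.completeGraph (Fin 2)) (SimpleGraph.pathGraph (n - 2))

/-! The number `n + 2` separates the two radii. A test vector on `K₂ ∇ P_{n-2}` has Rayleigh
quotient above `n + 2`, while `G` carries a positive vector `z` with `Q z ≤ (n + 2) z`, so `q(G) ≤ n
+ 2`.

Planarity enters only through the absence of `K₃,₃`: if `v₂` has the second largest degree and `N`
is the set of common neighbours of `v₁` and `v₂`, any third vertex has at most two neighbours in
`N`. This bounds the degrees in every row of `Q z`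
(`IsPlanarGraph.signlessRadius_le_of_dominating`); the two cases are `s = 1` and `s = 2`
non-neighbours of `v₂`.

That `K₃,₃` has no plane drawing is proved with winding: disjoint arcs satisfy a linear relation
between logarithmic increments (`logIncrement_square`), and exponentiating a sum of these relations
gives a nonzero square equal to its own negative. -/

/-! ### Continuous logarithms and the non-planarity of `K₃,₃`. -/

/-- A continuous nowhere vanishing function on a real normed space has a continuous logarithm. -/
theorem exists_continuous_log {E : Type*} [NormedAddCommGroup E] [NormedSpace ℝ E]
    {f : E → ℂ} (hf : Continuous f) (h0 : ∀ x, f x ≠ 0) :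
    ∃ g : E → ℂ, Continuous g ∧ ∀ x, Complex.exp (g x) = f x := by
  obtain ⟨F, ⟨-, hF⟩, -⟩ := Complex.isCoveringMapOn_exp.existsUnique_continuousMap_lifts
    (⟨f, hf⟩ : C(E, ℂ)) (a₀ := 0) (Complex.exp_log (h0 0)) (fun x => h0 x)
  exact ⟨F, F.continuous, fun x => congrFun hF x⟩

open scoped Classical in
/-- The increment over `[0, 1]` of a continuous logarithm of `h`. -/
noncomputable def logIncrement (h : ℝ → ℂ) : ℂ :=
  if H : ∃ g : ℝ → ℂ, Continuous g ∧ ∀ x, Complex.exp (g x) = h x then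
    H.choose 1 - H.choose 0 else 0

/-- Two continuous logarithms of the same function, up to a constant factor, have the same
increments. -/
theorem sub_eq_sub_of_exp_eq_mul {g g' : ℝ → ℂ} (hg : Continuous g) (hg' : Continuous g') {c : ℂ}
    (h : ∀ x, Complex.exp (g' x) = c * Complex.exp (g x)) (x y : ℝ) :
    g x - g y = g' x - g' y := by
  have hq : ∀ z, Complex.exp (g' z - g z) = c := fun z => by
    rw [Complex.exp_sub, h, mul_div_assoc, div_self (Complex.exp_ne_zero _), mul_one]
  -- Both sides lift the same constant map through the covering `exp` and agree at `0`.
  have hconst : (fun z => g' z - g z) = fun _ => g' 0 - g 0 := by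
    have hcov := Complex.isCoveringMap_exp
    refine hcov.eq_of_comp_eq (hg'.sub hg) continuous_const ?_ 0 rfl
    funext z
    exact Subtype.ext (by simp only [Function.comp_apply]; rw [hq, hq])
  have hx := congrFun hconst x
  have hy := congrFun hconst y
  linear_combination hy - hx

/-- The factor `c` is there for `c = -1`, which turns a logarithm of `f - g` into one for `g - f`.
-/
theorem logIncrement_eq {h g : ℝ → ℂ} {c : ℂ} (hh : Continuous h) (h0 : ∀ x, h x ≠ 0)
    (hg : Continuous g) (hgh : ∀ x, Complex.exp (g x) = c * h x) :
    logIncrement h = g 1 - g 0 := by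
  have H := exists_continuous_log hh h0
  rw [logIncrement, dif_pos H]
  exact sub_eq_sub_of_exp_eq_mul H.choose_spec.1 hg
    (fun x => by rw [hgh, H.choose_spec.2]) 1 0

theorem exp_logIncrement {h : ℝ → ℂ} (hh : Continuous h) (h0 : ∀ x, h x ≠ 0) :
    Complex.exp (logIncrement h) = h 1 / h 0 := by
  obtain ⟨g, hg, hgh⟩ := exists_continuous_log hh h0
  rw [logIncrement_eq (c := 1) hh h0 hg (by simpa using hgh), Complex.exp_sub, hgh, hgh]

/-- Two disjoint plane curves: the logarithmic increments of the four differences between a curve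
and an end of the other one add up to zero around the square. -/
theorem logIncrement_square {f g : ℝ → ℂ} (hf : Continuous f) (hg : Continuous g)
    (hfg : ∀ s t, f s ≠ g t) :
    logIncrement (fun s => f s - g 0) - logIncrement (fun s => f s - g 1) =
      logIncrement (fun t => g t - f 0) - logIncrement (fun t => g t - f 1) := by
  obtain ⟨L, hL, hLe⟩ := exists_continuous_log (E := ℝ × ℝ) (f := fun p => f p.1 - g p.2)
    (by fun_prop) (fun p => sub_ne_zero.2 (hfg _ _))
  have h1 : ∀ t, logIncrement (fun s => f s - g t) = L (1, t) - L (0, t) := fun t =>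
    logIncrement_eq (c := 1) (g := fun s => L (s, t)) (by fun_prop)
      (fun s => sub_ne_zero.2 (hfg _ _)) (by fun_prop) (fun s => by rw [hLe, one_mul])
  have h2 : ∀ s, logIncrement (fun t => g t - f s) = L (s, 1) - L (s, 0) := fun s =>
    logIncrement_eq (c := -1) (g := fun t => L (s, t)) (by fun_prop)
      (fun t => sub_ne_zero.2 (hfg _ _).symm) (by fun_prop) (fun t => by rw [hLe]; ring)
  rw [h1, h1, h2, h2]
  ring

/-- The complete bipartite graph `K₃,₃` has no drawing in the complex plane in which the curves of
any two edges without a common end are disjoint. -/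
theorem not_exists_drawing_K33 (a b : Fin 3 → ℂ) (f : Fin 3 → Fin 3 → ℝ → ℂ)
    (hf : ∀ i j, Continuous (f i j)) (hf0 : ∀ i j, f i j 0 = a i) (hf1 : ∀ i j, f i j 1 = b j)
    (hdisj : ∀ i j k l, i ≠ k → j ≠ l → ∀ s t, f i j s ≠ f k l t) : False := by
  have hother : ∀ i : Fin 3, ∃ j, i ≠ j := by decide
  set u : Fin 3 → Fin 3 → Fin 3 → ℂ := fun i j k => logIncrement fun s => f i j s - a k with hu
  set v : Fin 3 → Fin 3 → Fin 3 → ℂ := fun i j l => logIncrement fun s => f i j s - b l with hv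
  have hsq : ∀ i j k l, i ≠ k → j ≠ l → u i j k - v i j l = u k l i - v k l j := by
    intro i j k l hik hjl
    have := logIncrement_square (hf i j) (hf k l) (hdisj i j k l hik hjl)
    simpa only [hf0, hf1] using this
  have hab : ∀ i j, b j - a i ≠ 0 := by
    intro i j
    obtain ⟨k, hk⟩ := hother i
    obtain ⟨l, hl⟩ := hother j
    have := hdisj k j i l hk.symm hl 1 0
    rw [hf0, hf1] at this
    exact sub_ne_zero.2 this
  have haa : ∀ i k, i ≠ k → a i - a k ≠ 0 := by
    intro i k hik
    have := hdisj i 0 k 1 hik (by decide) 0 0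
    rw [hf0, hf0] at this
    exact sub_ne_zero.2 this
  have hbb : ∀ j l, j ≠ l → b j - b l ≠ 0 := by
    intro j l hjl
    have := hdisj 0 j 1 l (by decide) hjl 1 1
    rw [hf1, hf1] at this
    exact sub_ne_zero.2 this
  have hue : ∀ i j k, i ≠ k → Complex.exp (u i j k) = (b j - a k) / (a i - a k) := by
    intro i j k hik
    obtain ⟨l, hl⟩ := hother j
    rw [hu]
    simp only
    rw [exp_logIncrement (by fun_prop), hf0, hf1]
    intro s
    have := hdisj i j k l hik hl s 0
    rw [hf0] at this
    exact sub_ne_zero.2 this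
  have hve : ∀ i j l, j ≠ l → Complex.exp (v i j l) = (b j - b l) / (a i - b l) := by
    intro i j l hjl
    obtain ⟨k, hk⟩ := hother i
    rw [hv]
    simp only
    rw [exp_logIncrement (by fun_prop), hf0, hf1]
    intro s
    have := hdisj i j k l hk hjl s 1
    rw [hf1] at this
    exact sub_ne_zero.2 this
  -- Each of the three `j` contributes a sign from `(a k - a i) / (a i - a k)`, and `(-1) ^ 3 = -1`.
  have hU : ∀ i k, i ≠ k → Complex.exp (∑ j, (u i j k - u k j i)) =
      -((∏ j, (b j - a k)) / ∏ j, (b j - a i)) := by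
    intro i k hik
    rw [Complex.exp_sum]
    have : ∀ j, Complex.exp (u i j k - u k j i) = -((b j - a k) / (b j - a i)) := by
      intro j
      rw [Complex.exp_sub, hue _ _ _ hik, hue _ _ _ hik.symm, ← neg_sub (a i) (a k)]
      have := haa i k hik
      have := hab i j
      field_simp
    simp only [this, Fin.prod_univ_three]
    have := hab i
    field_simp [this 0, this 1, this 2]
  have hV : ∀ j l, j ≠ l → Complex.exp (v 0 j l - v 2 j l) = (b l - a 2) / (b l - a 0) := by
    intro j l hjl
    rw [Complex.exp_sub, hve _ _ _ hjl, hve _ _ _ hjl, ← neg_sub (b l) (a 0),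
      ← neg_sub (b l) (a 2)]
    have := hbb j l hjl
    have := hab 0 l
    have := hab 2 l
    field_simp
  -- Adding the relations over `i < k` and all `j ≠ l` counts every term twice. The halving has to
  -- precede `exp`, since squaring would lose the sign.
  have hsum : (∑ j, (u 0 j 1 - u 1 j 0)) + (∑ j, (u 0 j 2 - u 2 j 0)) +
      (∑ j, (u 1 j 2 - u 2 j 1)) =
      (v 0 0 1 - v 2 0 1) + (v 0 0 2 - v 2 0 2) + (v 0 1 0 - v 2 1 0) + (v 0 1 2 - v 2 1 2) +
      (v 0 2 0 - v 2 2 0) + (v 0 2 1 - v 2 2 1) := by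
    have h : ∀ i k, i ≠ k → ∀ j l, j ≠ l → u i j k - u k l i = v i j l - v k l j :=
      fun i k hik j l hjl => by linear_combination hsq i j k l hik hjl
    have h01 := h 0 1 (by decide)
    have h02 := h 0 2 (by decide)
    have h12 := h 1 2 (by decide)
    have n01 : (0 : Fin 3) ≠ 1 := by decide
    have n02 : (0 : Fin 3) ≠ 2 := by decide
    have n12 : (1 : Fin 3) ≠ 2 := by decide
    simp only [Fin.sum_univ_three]
    linear_combination (1 / 2 : ℂ) *
      (h01 0 1 n01 + h01 0 2 n02 + h01 1 0 n01.symm + h01 1 2 n12 + h01 2 0 n02.symm +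
        h01 2 1 n12.symm + h02 0 1 n01 + h02 0 2 n02 + h02 1 0 n01.symm + h02 1 2 n12 +
        h02 2 0 n02.symm + h02 2 1 n12.symm + h12 0 1 n01 + h12 0 2 n02 + h12 1 0 n01.symm +
        h12 1 2 n12 + h12 2 0 n02.symm + h12 2 1 n12.symm)
  have hexp := congrArg Complex.exp hsum
  simp only [Complex.exp_add] at hexp
  rw [hU 0 1 (by decide), hU 0 2 (by decide), hU 1 2 (by decide), hV 0 1 (by decide),
    hV 0 2 (by decide), hV 1 0 (by decide), hV 1 2 (by decide), hV 2 0 (by decide),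
    hV 2 1 (by decide)] at hexp
  have hP : ∀ i, ∏ j, (b j - a i) ≠ 0 := fun i => Finset.prod_ne_zero_iff.2 fun j _ => hab i j
  have hr : (b 1 - a 2) / (b 1 - a 0) * ((b 2 - a 2) / (b 2 - a 0)) *
      ((b 0 - a 2) / (b 0 - a 0)) * ((b 2 - a 2) / (b 2 - a 0)) *
      ((b 0 - a 2) / (b 0 - a 0)) * ((b 1 - a 2) / (b 1 - a 0)) =
      ((∏ j, (b j - a 2)) / ∏ j, (b j - a 0)) ^ 2 := by
    simp only [Fin.prod_univ_three, div_pow, div_mul_div_comm]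
    congr 1 <;> ring
  rw [hr] at hexp
  have h0 := hP 0
  have h1 := hP 1
  have h2 := hP 2
  generalize ∏ j, (b j - a 0) = X at *
  generalize ∏ j, (b j - a 1) = Y at *
  generalize ∏ j, (b j - a 2) = Z at *
  have hl : -(Y / X) * -(Z / X) * -(Z / Y) = -(Z / X) ^ 2 := by
    field_simp
  rw [hl] at hexp
  have : (Z / X) ^ 2 = 0 := by linear_combination (-1 / 2 : ℂ) * hexp
  exact pow_ne_zero 2 (div_ne_zero h2 h0) this

/-- A planar graph contains no `K₃,₃`. -/
theorem IsPlanarGraph.not_K33 {V : Type*} {G : SimpleGraph V} (hG : IsPlanarGraph G)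
    (a b : Fin 3 → V) (ha : Function.Injective a) (hb : Function.Injective b) :
    ¬ ∀ i j, G.Adj (a i) (b j) := by
  intro hab
  obtain ⟨D⟩ := hG
  let φ := Complex.orthonormalBasisOneI.repr.symm
  refine not_exists_drawing_K33 (fun i => φ (D.point (a i))) (fun j => φ (D.point (b j)))
    (fun i j t => φ ((D.curve _ _ (hab i j)).extend t))
    (fun i j => φ.continuous.comp (Path.continuous_extend _)) (fun i j => by simp)
    (fun i j => by simp) ?_
  intro i j k l hik hjl s t hst
  have hst' := φ.injective hst
  have hik' := ha.ne hik
  have hjl' := hb.ne hjl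
  have hil := (hab i l).ne
  have hkj := (hab k j).ne
  obtain ⟨w, hw, hw', -⟩ := D.curve_meet _ _ (hab i j) _ _ (hab k l)
    (by rw [Ne, Sym2.eq_iff]; tauto) (Set.projIcc 0 1 zero_le_one s)
    (Set.projIcc 0 1 zero_le_one t) hst'
  rw [Sym2.mem_iff] at hw hw'
  rcases hw with rfl | rfl <;> rcases hw' with h | h
  · exact hik' h
  · exact hil h
  · exact hkj h.symm
  · exact hjl' h

/-! ### Bounds for the signless Laplacian radius from test vectors. -/

theorem signlessLaplacian_mulVec_apply {V : Type*} [Fintype V] [DecidableEq V]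
    (G : SimpleGraph V) [DecidableRel G.Adj] (x : V → ℝ) (v : V) :
    (signlessLaplacian G).mulVec x v = ∑ w ∈ G.neighborFinset v, (x v + x w) := by
  rw [signlessLaplacian, Matrix.add_mulVec, Pi.add_apply, SimpleGraph.degMatrix_mulVec_apply,
    SimpleGraph.adjMatrix_mulVec_apply, Finset.sum_add_distrib, Finset.sum_const,
    SimpleGraph.card_neighborFinset_eq_degree, nsmul_eq_mul]

/-- A positive vector `z` with `Q z ≤ c z` shows that the signless Laplacian spectral radius is at
most `c`. -/
theorem signlessRadius_le {V : Type*} [Fintype V] [Nonempty V] (G : SimpleGraph V)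
    [DecidableRel G.Adj] (z : V → ℝ) (hz : ∀ v, 0 < z v) (c : ℝ)
    (h : ∀ v, ∑ w ∈ G.neighborFinset v, (z v + z w) ≤ c * z v) : signlessRadius G ≤ c := by
  classical
  have hev := (isGreatest_signlessRadius G).1
  obtain ⟨x, hx, hx0⟩ := Module.End.HasEigenvalue.exists_hasEigenvector hev
  have heig := Module.End.mem_eigenspace_iff.1 hx
  -- The eigenvalue equation is read at a vertex maximizing `|x| / z`.
  obtain ⟨v, -, hv⟩ := Finset.exists_max_image Finset.univ (fun v => |x v| / z v)
    Finset.univ_nonempty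
  set M := |x v| / z v with hM
  have hle : ∀ w, |x w| ≤ M * z w := fun w =>
    (div_le_iff₀ (hz w)).1 (hv w (Finset.mem_univ w))
  have hvM : |x v| = M * z v := by rw [hM, div_mul_cancel₀ _ (hz v).ne']
  have hMpos : 0 < M := by
    by_contra! hM0
    apply hx0
    funext w
    exact abs_nonpos_iff.1 ((hle w).trans (mul_nonpos_of_nonpos_of_nonneg hM0 (hz w).le))
  have hrow : ∑ w ∈ G.neighborFinset v, (x v + x w) = signlessRadius G * x v := by
    have := congrFun heig v
    rw [Matrix.toLin'_apply, signlessLaplacian_mulVec_apply] at this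
    simp only [Pi.smul_apply, smul_eq_mul] at this
    rw [← this]
    congr!
  have hbound : signlessRadius G * |x v| ≤ c * |x v| := by
    calc signlessRadius G * |x v| ≤ |signlessRadius G * x v| := by
          rw [abs_mul]; exact mul_le_mul_of_nonneg_right (le_abs_self _) (abs_nonneg _)
      _ ≤ ∑ w ∈ G.neighborFinset v, |x v + x w| := by
          rw [← hrow]; exact Finset.abs_sum_le_sum_abs _ _
      _ ≤ ∑ w ∈ G.neighborFinset v, M * (z v + z w) := by
          refine Finset.sum_le_sum fun w _ => (abs_add_le _ _).trans ?_
          rw [mul_add]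
          exact add_le_add (hle v) (hle w)
      _ = M * ∑ w ∈ G.neighborFinset v, (z v + z w) := by rw [Finset.mul_sum]
      _ ≤ M * (c * z v) := mul_le_mul_of_nonneg_left (h v) hMpos.le
      _ = c * |x v| := by rw [hvM]; ring
  refine le_of_mul_le_mul_right hbound ?_
  rw [hvM]
  exact mul_pos hMpos (hz v)

/-- A vector with Rayleigh quotient above `c` shows that the signless Laplacian spectral radius is
above `c`. -/
theorem lt_signlessRadius {V : Type*} [Fintype V] [Nonempty V] (G : SimpleGraph V)
    [DecidableRel G.Adj] (x : V → ℝ) (c : ℝ)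
    (h : c * ∑ v, x v ^ 2 < ∑ v, x v * ∑ w ∈ G.neighborFinset v, (x v + x w)) :
    c < signlessRadius G := by
  classical
  by_contra! hc
  have hherm : (c • (1 : Matrix V V ℝ) - signlessLaplacian G).IsHermitian := by
    refine Matrix.IsHermitian.sub ?_ (Matrix.IsHermitian.add ?_ ?_)
    · simp [Matrix.IsHermitian]
    · exact Matrix.isHermitian_diagonal _
    · exact Matrix.IsHermitian.ext fun i j => by simp [SimpleGraph.adj_comm]
  have hpsd : (c • (1 : Matrix V V ℝ) - signlessLaplacian G).PosSemidef := by
    rw [hherm.posSemidef_iff_eigenvalues_nonneg]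
    intro i
    have hmem := hherm.eigenvalues_mem_spectrum_real i
    generalize hherm.eigenvalues i = e at hmem ⊢
    rw [← Algebra.algebraMap_eq_smul_one, ← spectrum.singleton_sub_eq, Set.singleton_sub] at hmem
    obtain ⟨μ, hμ, hμi⟩ := hmem
    have : μ ≤ signlessRadius G := by
      refine (isGreatest_signlessRadius G).2 ?_
      rw [Set.mem_ofPred_eq, Module.End.hasEigenvalue_iff_mem_spectrum, Matrix.spectrum_toLin']
      convert! hμ
    have h0 := this.trans hc
    simp only [Pi.zero_apply] at hμi ⊢
    linarith
  have hq := hpsd.dotProduct_mulVec_nonneg x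
  rw [Matrix.sub_mulVec, dotProduct_sub, Matrix.smul_mulVec, Matrix.one_mulVec] at hq
  simp only [dotProduct, signlessLaplacian_mulVec_apply, star_trivial, Pi.smul_apply,
    smul_eq_mul] at hq
  rw [Finset.mul_sum] at h
  have : ∀ v, x v * (c * x v) = c * x v ^ 2 := fun v => by ring
  simp only [this] at hq
  linarith

/-! ### The lower bound for `K₂ ∇ P_{n-2}`. -/

theorem le_sum_degree_pathGraph (m : ℕ) [DecidableRel (SimpleGraph.pathGraph (m + 1)).Adj] :
    2 * (m : ℝ) ≤ ∑ v, ((SimpleGraph.pathGraph (m + 1)).degree v : ℝ) := by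
  classical
  have h := (SimpleGraph.pathGraph_connected m).card_vert_le_card_edgeSet_add_one
  rw [Nat.card_eq_fintype_card, Nat.card_eq_fintype_card, Fintype.card_fin,
    ← SimpleGraph.edgeFinset_card] at h
  have h2 := (SimpleGraph.pathGraph (m + 1)).sum_degrees_eq_twice_card_edges
  have h3 : 2 * m ≤ ∑ v, (SimpleGraph.pathGraph (m + 1)).degree v := by
    rw [h2]; omega
  exact_mod_cast h3

theorem lt_signlessRadius_joinK2Path (m : ℕ) (hm : 5 ≤ m) :
    (m : ℝ) + 5 < signlessRadius (joinK2Path (m + 3)) := by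
  classical
  have hsum : ∀ (v : Fin 2 ⊕ Fin (m + 3 - 2)) (g : Fin 2 ⊕ Fin (m + 3 - 2) → ℝ),
      ∑ w ∈ (joinK2Path (m + 3)).neighborFinset v, g w =
      ∑ w, if (joinK2Path (m + 3)).Adj v w then g w else 0 := by
    intro v g
    rw [SimpleGraph.neighborFinset_eq_filter, Finset.sum_filter]
  have hdeg : ∀ i, ((SimpleGraph.pathGraph (m + 1)).degree i : ℝ) =
      ∑ j, if (SimpleGraph.pathGraph (m + 1)).Adj i j then (1 : ℝ) else 0 := by
    intro i
    rw [← SimpleGraph.card_neighborFinset_eq_degree, SimpleGraph.neighborFinset_eq_filter,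
      Finset.sum_boole]
  -- An approximate Perron vector: the two sides of the Rayleigh inequality differ by at least `8 *
  -- m - 24`.
  refine lt_signlessRadius _ (Sum.elim (fun _ => (m : ℝ) + 3) fun _ => 2) _ ?_
  simp only [hsum, Fintype.sum_sum_type]
  have hll : ∀ a b, (joinK2Path (m + 3)).Adj (Sum.inl a) (Sum.inl b) ↔ a ≠ b := fun _ _ => Iff.rfl
  have hlr : ∀ a b, (joinK2Path (m + 3)).Adj (Sum.inl a) (Sum.inr b) ↔ True := fun _ _ => Iff.rfl
  have hrl : ∀ a b, (joinK2Path (m + 3)).Adj (Sum.inr a) (Sum.inl b) ↔ True := fun _ _ => Iff.rfl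
  have hrr : ∀ a b, (joinK2Path (m + 3)).Adj (Sum.inr a) (Sum.inr b) ↔
    (SimpleGraph.pathGraph (m + 1)).Adj a b := fun _ _ => Iff.rfl
  have hpath : ∀ i, (∑ j : Fin (m + 1), if (SimpleGraph.pathGraph (m + 1)).Adj i j
      then ((2 : ℝ) + 2) else 0) = 4 * (SimpleGraph.pathGraph (m + 1)).degree i := by
    intro i
    rw [hdeg, Finset.mul_sum]
    exact Finset.sum_congr rfl fun j _ => by split_ifs <;> norm_num
  have hpd := le_sum_degree_pathGraph m
  have hm' : (5 : ℝ) ≤ m := by exact_mod_cast hm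
  simp only [Sum.elim_inl, Sum.elim_inr, hll, hlr, hrl, hrr, if_true]
  change _ < _ + ∑ i : Fin (m + 1), (2 : ℝ) * (_ + ∑ j : Fin (m + 1), _)
  simp only [hpath, mul_add, Finset.sum_add_distrib, ← Finset.mul_sum]
  simp [Fin.sum_univ_two]
  nlinarith

/-! ### The upper bound for planar graphs with a dominating vertex. -/

/-- In a planar graph, two common neighbours `v₁`, `v₂` of a set `N` leave every third vertex with at
most two neighbours in `N`. -/
theorem IsPlanarGraph.card_neighborFinset_inter_le {V : Type*} [Fintype V] [DecidableEq V]
    {G : SimpleGraph V} [DecidableRel G.Adj] (hG : IsPlanarGraph G) {v₁ v₂ w : V} (h12 : v₁ ≠ v₂)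
    (hw1 : w ≠ v₁) (hw2 : w ≠ v₂) {N : Finset V} (h1 : ∀ x ∈ N, G.Adj v₁ x)
    (h2 : ∀ x ∈ N, G.Adj v₂ x) : (G.neighborFinset w ∩ N).card ≤ 2 := by
  by_contra! h
  obtain ⟨t, ht, htc⟩ := Finset.exists_subset_card_eq (show 3 ≤ _ from h)
  let e := t.equivFinOfCardEq htc
  have hmem : ∀ j, (e.symm j : V) ∈ G.neighborFinset w ∩ N := fun j => ht (e.symm j).2
  refine hG.not_K33 ![v₁, v₂, w] (fun j => e.symm j) ?_
    (Subtype.val_injective.comp e.symm.injective) ?_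
  · intro i j hij
    fin_cases i <;> fin_cases j <;> simp_all
  · intro i j
    obtain ⟨hw, hN⟩ := Finset.mem_inter.1 (hmem j)
    fin_cases i
    · exact h1 _ hN
    · exact h2 _ hN
    · exact (G.mem_neighborFinset _ _).1 hw

/-- A planar graph with a dominating vertex `v₁` and a vertex `v₂` that misses `s` vertices: the
signless Laplacian spectral radius is bounded as soon as some numbers `b`, `y`, `δ`, `c` satisfy
the inequalities under which the vector that is `1` at `v₁`, `b` at `v₂`, `c` at the
non-neighbours of `v₂` and `y + k δ` at a neighbour of `v₂` adjacent to `k` of these is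
superharmonic. -/
theorem IsPlanarGraph.signlessRadius_le_of_dominating {V : Type*} [Fintype V] {G : SimpleGraph V}
    [DecidableRel G.Adj] (hG : IsPlanarGraph G) {v₁ v₂ : V} (h12 : v₁ ≠ v₂)
    (h1 : ∀ w, w ≠ v₁ → G.Adj v₁ w) {n s : ℕ} (hn : Fintype.card V = n)
    (hs : G.degree v₂ + 1 + s = n) {b y δ c : ℝ} (hb : 0 < b) (hy : 0 < y) (hδ : 0 ≤ δ)
    (hc : 0 < c)
    (hrow1 : ((n : ℝ) - 1) + b + (n - 2 - s) * y + 2 * s * δ + s * c ≤ n + 2)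
    (hrow2 : ((n : ℝ) - 1 - s) * b + 1 + (n - 2 - s) * y + 2 * s * δ ≤ (n + 2) * b)
    (hrowN : ∀ k : ℕ, k ≤ s → (4 + k) * (y + k * δ) + 1 + b + 2 * y + 2 * s * δ + k * c ≤
      ((n : ℝ) + 2) * (y + k * δ))
    (hrowU : ((s : ℝ) + 2) * c + 1 + 2 * y + 2 * s * δ + (s - 1) * c ≤ (n + 2) * c) :
    signlessRadius G ≤ n + 2 := by
  classical
  have : Nonempty V := ⟨v₁⟩
  have h21 : G.Adj v₂ v₁ := (h1 v₂ h12.symm).symm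
  set N := (G.neighborFinset v₂).erase v₁ with hN
  set U := ((Finset.univ.erase v₁).erase v₂) \ N with hU
  have hmemN : ∀ w, w ∈ N ↔ w ≠ v₁ ∧ G.Adj v₂ w := fun w => by simp [hN]
  have hmemU : ∀ w, w ∈ U ↔ w ≠ v₁ ∧ w ≠ v₂ ∧ ¬ G.Adj v₂ w := fun w => by
    simp [hU, hmemN]; tauto
  have hNsub : N ⊆ (Finset.univ.erase v₁).erase v₂ := by
    intro w hw
    have := (hmemN w).1 hw
    simp [this.1, this.2.ne']
  have hNcard : N.card + 1 = G.degree v₂ := by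
    rw [hN, Finset.card_erase_add_one ((G.mem_neighborFinset _ _).2 h21),
      G.card_neighborFinset_eq_degree]
  have hNU : U.card + N.card + 2 = n := by
    rw [hU, Finset.card_sdiff_add_card_eq_card hNsub, Finset.card_erase_of_mem (by simp [h12.symm]),
      Finset.card_erase_of_mem (by simp), Finset.card_univ, hn]
    have : 1 < Fintype.card V := Fintype.one_lt_card_iff.2 ⟨v₁, v₂, h12⟩
    omega
  have hUcard : U.card = s := by omega
  have hNcard' : (N.card : ℝ) = n - 2 - s := by
    rw [← hNU, hUcard]; push_cast; ring
  have hsplit : ∀ (S : Finset V) (g : V → ℝ), ∑ w ∈ S, g w =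
      (if v₁ ∈ S then g v₁ else 0) + (if v₂ ∈ S then g v₂ else 0) + ∑ w ∈ S ∩ N, g w +
        ∑ w ∈ S ∩ U, g w := by
    intro S g
    have hu : (Finset.univ : Finset V) = insert v₁ (insert v₂ (N ∪ U)) := by
      ext w
      simp only [Finset.mem_univ, Finset.mem_insert, Finset.mem_union, hmemN, hmemU, true_iff]
      tauto
    have hd : Disjoint N U := Finset.disjoint_sdiff
    rw [← Finset.univ_inter S, ← Finset.sum_ite_mem, hu, Finset.sum_insert, Finset.sum_insert,
      Finset.sum_union hd, Finset.sum_ite_mem, Finset.sum_ite_mem, Finset.inter_comm N,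
      Finset.inter_comm U, ← hu, Finset.univ_inter]
    · ring
    · simp [hmemN, hmemU]
    · simp [hmemN, hmemU, h12]
  have hK : ∀ w, w ≠ v₁ → w ≠ v₂ → (G.neighborFinset w ∩ N).card ≤ 2 := fun w hw1 hw2 =>
    hG.card_neighborFinset_inter_le h12 hw1 hw2 (fun x hx => h1 x ((hmemN x).1 hx).1)
      (fun x hx => ((hmemN x).1 hx).2)
  set k : V → ℕ := fun w => (G.neighborFinset w ∩ U).card with hk
  have hks : ∀ w, k w ≤ s := fun w => hUcard ▸ Finset.card_le_card Finset.inter_subset_right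
  -- The edges between `N` and `U` are counted from `U`, where each vertex has at most two.
  have hksum : ∑ w ∈ N, (k w : ℝ) ≤ 2 * s := by
    have hdc : ∑ w ∈ N, k w = ∑ u ∈ U, (G.neighborFinset u ∩ N).card := by
      have ha : ∀ w, G.neighborFinset w ∩ U = Finset.bipartiteAbove G.Adj U w := fun w => by
        ext x; simp [Finset.bipartiteAbove, and_comm]
      have hb : ∀ w, G.neighborFinset w ∩ N = Finset.bipartiteBelow G.Adj N w := fun w => by
        ext x; simp [Finset.bipartiteBelow, and_comm, G.adj_comm]
      simp only [hk, ha, hb]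
      exact Finset.sum_card_bipartiteAbove_eq_sum_card_bipartiteBelow G.Adj
    have : ∑ w ∈ N, k w ≤ 2 * s := by
      rw [hdc]
      refine (Finset.sum_le_card_nsmul U _ 2 fun u hu => ?_).trans (by rw [hUcard]; simp [mul_comm])
      exact hK u ((hmemU u).1 hu).1 ((hmemU u).1 hu).2.1
    exact_mod_cast this
  set z : V → ℝ := fun w => if w = v₁ then 1 else if w = v₂ then b else
    if w ∈ U then c else y + k w * δ with hz
  have hz1 : z v₁ = 1 := by simp [hz]
  have hz2 : z v₂ = b := by simp [hz, h12.symm]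
  have hzU : ∀ w ∈ U, z w = c := fun w hw => by
    have := (hmemU w).1 hw
    simp only [hz]
    rw [if_neg this.1, if_neg this.2.1, if_pos hw]
  have hzN : ∀ w ∈ N, z w = y + k w * δ := fun w hw => by
    have h := (hmemN w).1 hw
    simp only [hz]
    rw [if_neg h.1, if_neg h.2.ne', if_neg fun hU => ((hmemU w).1 hU).2.2 h.2]
  have hsumU : ∀ S : Finset V, ∑ w ∈ S ∩ U, z w = (S ∩ U).card * c := fun S => by
    rw [Finset.sum_congr rfl fun w hw => hzU w (Finset.mem_inter.1 hw).2]
    simp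
  have hsumN : ∀ S : Finset V, ∑ w ∈ S ∩ N, z w ≤ (S ∩ N).card * y + 2 * s * δ := fun S => by
    rw [Finset.sum_congr rfl fun w hw => hzN w (Finset.mem_inter.1 hw).2, Finset.sum_add_distrib,
      ← Finset.sum_mul]
    simp only [Finset.sum_const, nsmul_eq_mul]
    have : ∑ w ∈ S ∩ N, (k w : ℝ) ≤ ∑ w ∈ N, (k w : ℝ) :=
      Finset.sum_le_sum_of_subset_of_nonneg Finset.inter_subset_right fun _ _ _ => Nat.cast_nonneg _
    have := mul_le_mul_of_nonneg_right (this.trans hksum) hδ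
    linarith
  have hposN : ∀ w, 0 < y + k w * δ := fun w =>
    add_pos_of_pos_of_nonneg hy (mul_nonneg (Nat.cast_nonneg _) hδ)
  refine signlessRadius_le G z (fun w => ?_) _ fun v => ?_
  · simp only [hz]
    split_ifs
    exacts [one_pos, hb, hc, hposN w]
  rw [Finset.sum_add_distrib, Finset.sum_const, G.card_neighborFinset_eq_degree, nsmul_eq_mul]
  have hdeg : (G.degree v : ℝ) = (if v₁ ∈ G.neighborFinset v then 1 else 0) +
      (if v₂ ∈ G.neighborFinset v then 1 else 0) + (G.neighborFinset v ∩ N).card + k v := by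
    have := hsplit (G.neighborFinset v) fun _ => 1
    simpa using this
  rw [hdeg, hsplit (G.neighborFinset v) z, hz1, hz2, hsumU]
  have hNv := hsumN (G.neighborFinset v)
  change _ + (_ + (k v : ℝ) * c) ≤ _
  have hcases : v = v₁ ∨ v = v₂ ∨ v ∈ N ∨ v ∈ U := by
    rw [hmemN, hmemU]; tauto
  rcases hcases with rfl | rfl | hv | hv
  · have e1 : G.neighborFinset v ∩ N = N := Finset.inter_eq_right.2 fun x hx => by
      simpa using h1 x ((hmemN x).1 hx).1
    have e2 : k v = s := by
      have : G.neighborFinset v ∩ U = U := Finset.inter_eq_right.2 fun x hx => by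
        simpa using h1 x ((hmemU x).1 hx).1
      rw [← hUcard]
      exact congrArg Finset.card this
    rw [e1, hNcard'] at hNv ⊢
    rw [e2, hz1]
    simp only [SimpleGraph.mem_neighborFinset, SimpleGraph.irrefl, h21.symm, if_true, if_false]
    linarith
  · have e1 : G.neighborFinset v ∩ N = N := Finset.inter_eq_right.2 fun x hx => by
      simpa using ((hmemN x).1 hx).2
    have e2 : k v = 0 := by
      rw [hk, Finset.card_eq_zero, ← Finset.disjoint_iff_inter_eq_empty, Finset.disjoint_left]
      intro x hx hxU
      exact ((hmemU x).1 hxU).2.2 (by simpa using hx)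
    rw [e1, hNcard'] at hNv ⊢
    rw [e2, hz2]
    simp only [SimpleGraph.mem_neighborFinset, SimpleGraph.irrefl, h21, if_true, if_false]
    push_cast
    linarith
  · have h := (hmemN v).1 hv
    have hd : ((G.neighborFinset v ∩ N).card : ℝ) ≤ 2 := by exact_mod_cast hK v h.1 h.2.ne'
    rw [hzN v hv]
    simp only [SimpleGraph.mem_neighborFinset, (h1 v h.1).symm, h.2.symm, if_true]
    have hr := hrowN (k v) (hks v)
    have t1 := mul_le_mul_of_nonneg_right hd (hposN v).le
    have t2 := mul_le_mul_of_nonneg_right hd hy.le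
    linarith
  · have h := (hmemU v).1 hv
    have hd : ((G.neighborFinset v ∩ N).card : ℝ) ≤ 2 := by exact_mod_cast hK v h.1 h.2.1
    have h2v : ¬ G.Adj v v₂ := fun hh => h.2.2 hh.symm
    -- A vertex of `U` is not its own neighbour.
    have hkv : (k v : ℝ) ≤ s - 1 := by
      have : k v < s := by
        rw [← hUcard]
        refine Finset.card_lt_card (Finset.ssubset_iff_subset_ne.2 ⟨Finset.inter_subset_right, ?_⟩)
        intro he
        have := he ▸ hv
        simp at this
      have : k v + 1 ≤ s := this
      have : (k v : ℝ) + 1 ≤ s := by exact_mod_cast this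
      linarith
    rw [hzU v hv]
    simp only [SimpleGraph.mem_neighborFinset, (h1 v h.1).symm, h2v, if_true, if_false]
    have t1 := mul_le_mul_of_nonneg_right hd hc.le
    have t2 := mul_le_mul_of_nonneg_right hd hy.le
    have t3 := mul_le_mul_of_nonneg_right hkv hc.le
    linarith

/-! ### The vertex of second largest degree and the two cases. -/

theorem exists_ne_degree_eq_secondMaxDegree {V : Type*} [Fintype V] (G : SimpleGraph V)
    [DecidableRel G.Adj] {v₁ : V} (h : secondMaxDegree G ≠ 0) (hv₁ : G.degree v₁ = G.maxDegree)
    (hlt : secondMaxDegree G ≠ G.maxDegree) :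
    ∃ v₂, v₁ ≠ v₂ ∧ G.degree v₂ = secondMaxDegree G := by
  -- The supremum of the empty multiset is `0`, so attainment needs a nonzero value.
  have key : ∀ S : Multiset ℕ, S.sup ≠ 0 → S.sup ∈ S := by
    intro S
    induction S using Multiset.induction with
    | empty => simp
    | cons a S ih =>
      intro h0
      rw [Multiset.sup_cons] at h0 ⊢
      rcases le_total a S.sup with hle | hle
      · rw [sup_eq_right.2 hle] at h0 ⊢
        exact Multiset.mem_cons_of_mem (ih h0)
      · rw [sup_eq_left.2 hle]
        exact Multiset.mem_cons_self _ _
  have hmem := Multiset.mem_of_mem_erase (key _ h)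
  obtain ⟨v₂, -, hv₂⟩ := Multiset.mem_map.1 hmem
  refine ⟨v₂, ?_, hv₂⟩
  rintro rfl
  exact hlt (hv₂.symm.trans hv₁)

theorem lemma3p11 {V : Type*} [Fintype V] (G : SimpleGraph V) [DecidableRel G.Adj]
    (n : ℕ) (hn : 15 ≤ n) (hcard : Fintype.card V = n) (hG : IsMaximalPlanarGraph G)
    (v₁ : V) (hv₁ : G.degree v₁ = G.maxDegree) (hΔ : G.maxDegree = n - 1) :
    (secondMaxDegree G = n - 2 → signlessRadius G < signlessRadius (joinK2Path n)) ∧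
    (secondMaxDegree G = n - 3 → signlessRadius G < signlessRadius (joinK2Path n)) := by
  classical
  have hn' : (15 : ℝ) ≤ n := by exact_mod_cast hn
  have hlower : (n : ℝ) + 2 < signlessRadius (joinK2Path n) := by
    obtain ⟨m, rfl⟩ := Nat.exists_eq_add_of_le' (show 3 ≤ n by omega)
    have := lt_signlessRadius_joinK2Path m (by omega)
    push_cast
    linarith
  have hdom : ∀ w, w ≠ v₁ → G.Adj v₁ w := by
    have : G.neighborFinset v₁ = Finset.univ.erase v₁ := by
      refine Finset.eq_of_subset_of_card_le (fun w hw => ?_) ?_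
      · simpa using ((G.mem_neighborFinset _ _).1 hw).ne'
      · rw [G.card_neighborFinset_eq_degree, hv₁, hΔ, Finset.card_erase_of_mem (by simp),
          Finset.card_univ, hcard]
    intro w hw
    rw [← G.mem_neighborFinset, this]
    simp [hw]
  -- With `y = K / (n - 4)` the product `n * y` becomes linear in `y`, and `n ≥ 15` gives the bound
  -- by `K / 11`.
  have hK : ∀ K : ℝ, 0 < K → ∃ y : ℝ, 0 < y ∧ n * y = K + 4 * y ∧ y ≤ K / 11 := by
    intro K hK0
    have h4 : (0 : ℝ) < n - 4 := by linarith
    refine ⟨K / (n - 4), by positivity, ?_, ?_⟩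
    · field_simp; ring
    · exact div_le_div_of_nonneg_left hK0.le (by norm_num) (by linarith)
  refine ⟨fun h => ?_, fun h => ?_⟩ <;> refine lt_of_le_of_lt ?_ hlower <;>
    obtain ⟨v₂, h12, hv₂⟩ :=
      exists_ne_degree_eq_secondMaxDegree G (v₁ := v₁) (by omega) hv₁ (by omega)
  -- Here and below `K = 1 + b + 2 * s * δ`, which makes the row of a vertex of `N` with `k = 0`
  -- tight; the other constants are numerical choices.
  · obtain ⟨y, hy0, hny, hy⟩ := hK (183 / 100) (by norm_num)
    refine hG.1.signlessRadius_le_of_dominating h12 hdom hcard (s := 1) (by omega)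
      (b := 77 / 100) (y := y) (δ := 3 / 100) (c := 13 / 100) (by norm_num) hy0 (by norm_num)
      (by norm_num) ?_ ?_ (fun k hk => ?_) ?_
    · push_cast; linarith
    · push_cast; linarith
    · interval_cases k <;> push_cast <;> linarith
    · push_cast; linarith
  · obtain ⟨y, hy0, hny, hy⟩ := hK (177 / 100) (by norm_num)
    refine hG.1.signlessRadius_le_of_dominating h12 hdom hcard (s := 2) (by omega)
      (b := 65 / 100) (y := y) (δ := 3 / 100) (c := 13 / 100) (by norm_num) hy0 (by norm_num)
      (by norm_num) ?_ ?_ (fun k hk => ?_) ?_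
    · push_cast; linarith
    · push_cast; linarith
    · interval_cases k <;> push_cast <;> linarith
    · push_cast; linarith
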